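/- **Proposition 3.3.** Let $\mathrm{O}(4,1;\mathbb{Z})$ be the group of matrices $g\in \mathrm{GL}_5(\mathbb{Z})$ with ${}^t g\,Q_0\,g=Q_0$, where $Q_0=\mathrm{diag}(1,1,1,1,-1)$, and for $N\ge 1$ let $\Gamma(N)=\{g\in \mathrm{O}(4,1;\mathbb{Z}) : g\equiv I \bmod N\}$ be its congruence subgroup of level $N$. For a group $G$ let $G_r^{(1)}$ denote the kernel of the natural homomorphism $G\to G^{ab}\otimes_{\mathbb{Z}}\mathbb{Q}$. A RFRS tower for a finitely generated group $G$ is a sequence of finite index subgroups $G=G_0\ge G_1\ge G_2\ge\cdots$ with $\bigcap_j G_j=\{1\}$ and $(G_j)_r^{(1)}\le G_{j+1}$ for all $j\ge 0$. The group $\Gamma(4)$ is finitely generated and admits a RFRS tower $\{\Gamma_j\}_{j\ge 0}$ such that for every $j$ there is an integer $n_j\ge 0$ with $\Gamma(2^{n_j})\le\Gamma_j$. -/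

import Mathlib

open scoped TensorProduct

/-- The natural homomorphism `G → G^ab ⊗ ℚ = H₁(G; ℚ)`. Its image is the rational
abelianization of `G`. -/
noncomputable def toRationalAbelianization (G : Type*) [Group G] :
    G →* Multiplicative (Additive (Abelianization G) ⊗[ℤ] ℚ) :=
  (AddMonoidHom.toMultiplicativeRight
    ((TensorProduct.mk ℤ (Additive (Abelianization G)) ℚ).flip 1).toAddMonoidHom).comp
    Abelianization.of

/-- The rational commutator subgroup of `G`: the kernel of `G → G^ab ⊗ ℚ`, equivalently the kernel
of the map from `G` onto its rational abelianization. -/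
noncomputable def rationalCommutator (G : Type*) [Group G] : Subgroup G :=
  (toRationalAbelianization G).ker

/-- A sequence `T 0, T 1, …` of subgroups is a RFRS tower for the finitely generated group `G`:
it starts at `G`, decreases, consists of finite index subgroups, has trivial intersection, and
the rational commutator subgroup of each term is contained in the next term. -/
structure IsRFRSTower {G : Type*} [Group G] (T : ℕ → Subgroup G) : Prop where
  fg : Group.FG G
  zero : T 0 = ⊤
  succ_le : ∀ j, T (j + 1) ≤ T j
  finiteIndex : ∀ j, (T j).FiniteIndex
  iInf_eq_bot : ⨅ j, T j = ⊥
  rationalCommutator_le : ∀ j, (rationalCommutator (T j)).map (T j).subtype ≤ T (j + 1)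

/-- The matrix `diag(1, 1, 1, 1, -1)`. -/
def lorentzMatrix : Matrix (Fin 5) (Fin 5) ℤ :=
  Matrix.diagonal ![1, 1, 1, 1, -1]

/-- `O(4,1;ℤ)`: the integral automorphisms of the quadratic form with matrix
`diag(1, 1, 1, 1, -1)`. -/
def integralLorentzGroup : Subgroup (GL (Fin 5) ℤ) where
  carrier := {g | (g : Matrix (Fin 5) (Fin 5) ℤ).transpose * lorentzMatrix *
    (g : Matrix (Fin 5) (Fin 5) ℤ) = lorentzMatrix}
  one_mem' := by simp
  mul_mem' := by
    intro a b ha hb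
    simp only [Set.mem_ofPred_eq] at ha hb ⊢
    calc _ = (b : Matrix (Fin 5) (Fin 5) ℤ).transpose *
          ((a : Matrix (Fin 5) (Fin 5) ℤ).transpose * lorentzMatrix * a.val) * b.val := by
            simp [Matrix.transpose_mul, Matrix.mul_assoc]
      _ = lorentzMatrix := by rw [ha, hb]
  inv_mem' := by
    intro a ha
    simp only [Set.mem_ofPred_eq] at ha ⊢
    have h1 : a.val * (a⁻¹).val = 1 := a.mul_inv
    have h2 : (a⁻¹).val.transpose * a.val.transpose = 1 := by
      rw [← Matrix.transpose_mul, h1, Matrix.transpose_one]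
    calc _ = (a⁻¹).val.transpose * (a.val.transpose * lorentzMatrix * a.val) * (a⁻¹).val := by
            rw [ha]
      _ = ((a⁻¹).val.transpose * a.val.transpose) * lorentzMatrix * (a.val * (a⁻¹).val) := by
            simp only [Matrix.mul_assoc]
      _ = lorentzMatrix := by rw [h1, h2, Matrix.one_mul, Matrix.mul_one]

/-- The level `N` congruence subgroup `Γ(N)` of `O(4,1;ℤ)`: the elements that are congruent to the
identity matrix modulo `N`. -/
def congruenceSubgroup (N : ℕ) : Subgroup integralLorentzGroup :=
  ((Matrix.GeneralLinearGroup.map (n := Fin 5) (Int.castRingHom (ZMod N))).comp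
    integralLorentzGroup.subtype).ker

/-!
The reflections in the vectors `e_i`, `i < 4`, and `e_i + e_j + e_4`, `i < j < 4`, generate a
subgroup `W` of `Γ(2)`: they are the reflections in the walls of a polytope, and the images of its
interior lattice point `b = basePoint` with positive last coordinate are moved back to it by a
descent on `-B(·, b)`. Hence `Γ(2)` is generated by `W` and `-1`, and a character modulo four shows
`Γ(4) ≤ W`.

For `g ∈ W` follow a path from the base point to its image under `g`. The displacement `g y - y` is
the sum over the crossed walls, with sign, of `B(u, y) v`, where `v` is the normal of the wall and
`u` the simple root congruent to `±v` modulo `2`: both sides are cocycles in `g` that agree on the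
generating reflections. On `Γ(N)` with `4 ∣ N`, the signed number of crossings of the walls whose
normals lie in a given class modulo `N` is a homomorphism to `ℤ`, so it vanishes on the rational
commutator subgroup. Since the normals `v` and `-v` contribute the same to the displacement, only
one of them, selected by a congruence modulo four, has to be counted. The displacement is
therefore twice a sum that vanishes modulo `N`, and the rational commutator subgroup of `Γ(N)` is
contained in `Γ(2N)`.
-/

open scoped Matrix

/-- The lattice `ℤ⁵` on which `O(4,1;ℤ)` acts. -/
abbrev LorentzLattice : Type := Fin 5 → ℤ

/-- The integral Lorentz form `x₀y₀ + x₁y₁ + x₂y₂ + x₃y₃ - x₄y₄`. -/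
def lorentzForm : LinearMap.BilinForm ℤ LorentzLattice :=
  Matrix.toBilin' lorentzMatrix

section LorentzForm

variable (x y : LorentzLattice)

theorem lorentzForm_apply :
    lorentzForm x y = x 0 * y 0 + x 1 * y 1 + x 2 * y 2 + x 3 * y 3 - x 4 * y 4 := by
  simp [lorentzForm, lorentzMatrix, Matrix.toBilin'_apply', dotProduct, Fin.sum_univ_five,
    Matrix.mulVec_diagonal, sub_eq_add_neg]

theorem lorentzForm_comm : lorentzForm x y = lorentzForm y x := by
  simp only [lorentzForm_apply]
  ring

theorem lorentzForm_smul_smul (g : integralLorentzGroup) :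
    lorentzForm (g • x) (g • y) = lorentzForm x y := by
  have isometry : (Matrix.toBilin' lorentzMatrix).comp (Matrix.toLin' g.1.val)
      (Matrix.toLin' g.1.val) = Matrix.toBilin' lorentzMatrix := by
    rw [Matrix.toBilin'_comp, g.2]
  exact LinearMap.congr_fun₂ isometry x y

theorem lorentzForm_smul_left (g : integralLorentzGroup) :
    lorentzForm (g • x) y = lorentzForm x (g⁻¹ • y) := by
  rw [← lorentzForm_smul_smul x, smul_inv_smul]

end LorentzForm

namespace integralLorentzGroup

theorem eq_of_smul_single_eq {g h : integralLorentzGroup}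
    (eq : ∀ i, g • (Pi.single i 1 : LorentzLattice) = h • (Pi.single i 1 : LorentzLattice)) :
    g = h :=
  Subtype.ext <| Units.ext <| Matrix.ext_of_mulVec_single eq

variable (e : LorentzLattice ≃ₗ[ℤ] LorentzLattice)
  (he : ∀ x y, lorentzForm (e x) (e y) = lorentzForm x y)

/-- The element of `O(4,1;ℤ)` given by a linear automorphism of `ℤ⁵` preserving the form. -/
noncomputable def ofIsometry : integralLorentzGroup :=
  ⟨Matrix.GeneralLinearGroup.toLin.symm
      ((LinearMap.GeneralLinearGroup.generalLinearEquiv ℤ LorentzLattice).symm e), by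
    change (LinearMap.toMatrix' e.toLinearMap).transpose * lorentzMatrix *
      LinearMap.toMatrix' e.toLinearMap = lorentzMatrix
    rw [← Matrix.toBilin'.injective.eq_iff, ← Matrix.toBilin'_comp, Matrix.toLin'_toMatrix']
    exact LinearMap.ext₂ he⟩

theorem ofIsometry_smul (v : LorentzLattice) : ofIsometry e he • v = e v :=
  LinearMap.toMatrix'_mulVec e.toLinearMap v

end integralLorentzGroup

section Congruence

variable {N : ℕ}

/-- Coordinatewise reduction modulo `N`. -/
def reduceMod (N : ℕ) : LorentzLattice →ₗ[ℤ] (Fin 5 → ZMod N) :=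
  (Int.castAddHom (ZMod N)).toIntLinearMap.compLeft (Fin 5)

theorem reduceMod_eq_iff {v w : LorentzLattice} :
    reduceMod N v = reduceMod N w ↔ ∀ i, v i ≡ w i [ZMOD N] :=
  funext_iff.trans <| forall_congr' fun i => ZMod.intCast_eq_intCast_iff (v i) (w i) N

theorem reduceMod_eq_of_dvd {M : ℕ} (h : M ∣ N) {v w : LorentzLattice}
    (hvw : reduceMod N v = reduceMod N w) : reduceMod M v = reduceMod M w :=
  reduceMod_eq_iff.2 fun i => (reduceMod_eq_iff.1 hvw i).of_dvd (Int.natCast_dvd_natCast.2 h)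

theorem mem_congruenceSubgroup_iff {g : integralLorentzGroup} :
    g ∈ congruenceSubgroup N ↔ ∀ v : LorentzLattice, reduceMod N (g • v) = reduceMod N v := by
  have mem_iff : g ∈ congruenceSubgroup N ↔
      g.1.val.map (Int.castRingHom (ZMod N)) = 1 := Units.ext_iff
  have reduce_smul (v : LorentzLattice) : reduceMod N (g • v) =
      g.1.val.map (Int.castRingHom (ZMod N)) *ᵥ reduceMod N v :=
    funext fun i => (Int.castRingHom (ZMod N)).map_mulVec g.1.val v i
  refine ⟨fun hg v => ?_, fun hg => ?_⟩
  · rw [reduce_smul, mem_iff.1 hg, Matrix.one_mulVec]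
  · refine mem_iff.2 <| Matrix.ext_of_mulVec_single fun j => ?_
    have single_one : reduceMod N (Pi.single j 1) = Pi.single j 1 := by
      ext i
      simp [reduceMod, Pi.single_apply]
    rw [← single_one, ← reduce_smul, hg, Matrix.one_mulVec]

theorem congruenceSubgroup_le_of_dvd {M : ℕ} (h : M ∣ N) :
    congruenceSubgroup N ≤ congruenceSubgroup M := fun _ hg =>
  mem_congruenceSubgroup_iff.2 fun v => reduceMod_eq_of_dvd h (mem_congruenceSubgroup_iff.1 hg v)

instance congruenceSubgroup_finiteIndex (N : ℕ) [NeZero N] :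
    (congruenceSubgroup N).FiniteIndex := by
  unfold congruenceSubgroup
  infer_instance

theorem lorentzForm_modEq {v w x y : LorentzLattice} (hv : reduceMod N v = reduceMod N w)
    (hx : reduceMod N x = reduceMod N y) :
    lorentzForm v x ≡ lorentzForm w y [ZMOD N] := by
  rw [reduceMod_eq_iff] at hv hx
  simp only [lorentzForm_apply]
  gcongr <;> apply_assumption

end Congruence

section Reflection

open integralLorentzGroup

/-- The reflection of the Lorentz lattice in the hyperplane orthogonal to a vector `n` of norm
one. -/
noncomputable def lorentzReflection (n : LorentzLattice) (hn : lorentzForm n n = 1) :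
    integralLorentzGroup :=
  ofIsometry (Module.reflection (x := n) (f := (2 : ℤ) • lorentzForm n) (by simp [hn]))
    fun x y => by
      simp only [Module.reflection_apply, LinearMap.smul_apply, smul_eq_mul, map_sub, map_smul,
        LinearMap.sub_apply, hn, lorentzForm_comm x n]
      ring

variable {n : LorentzLattice} (hn : lorentzForm n n = 1)

theorem lorentzReflection_smul (x : LorentzLattice) :
    lorentzReflection n hn • x = x - (2 * lorentzForm n x) • n := by
  rw [lorentzReflection, ofIsometry_smul, Module.reflection_apply, LinearMap.smul_apply,
    smul_eq_mul]

theorem lorentzReflection_smul_self : lorentzReflection n hn • n = -n := by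
  rw [lorentzReflection_smul, hn]
  module

theorem lorentzReflection_mul_self : lorentzReflection n hn * lorentzReflection n hn = 1 :=
  eq_of_smul_single_eq fun i => by
    simp only [mul_smul, lorentzReflection_smul, map_sub, map_smul, hn, one_smul, smul_eq_mul]
    module

theorem lorentzReflection_mem_congruenceSubgroup :
    lorentzReflection n hn ∈ congruenceSubgroup 2 := by
  refine mem_congruenceSubgroup_iff.2 fun v => reduceMod_eq_iff.2 fun i => ?_
  rw [lorentzReflection_smul]
  exact Int.modEq_iff_add_fac.2 ⟨lorentzForm n v * n i, by simp [mul_assoc]⟩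

/-- The central element `-1` of `O(4,1;ℤ)`. -/
noncomputable def lorentzNegOne : integralLorentzGroup :=
  ofIsometry (LinearEquiv.neg ℤ) fun x y => by simp

theorem lorentzNegOne_smul (x : LorentzLattice) : lorentzNegOne • x = -x :=
  ofIsometry_smul _ _ x

theorem lorentzNegOne_mem_congruenceSubgroup : lorentzNegOne ∈ congruenceSubgroup 2 := by
  refine mem_congruenceSubgroup_iff.2 fun v => reduceMod_eq_iff.2 fun i => ?_
  rw [lorentzNegOne_smul]
  exact Int.modEq_iff_add_fac.2 ⟨v i, by simp; ring⟩

end Reflection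

section ReflectionSubgroup

/-- The inward unit normals of the ten walls of the fundamental polytope of `Γ(2)`. -/
def simpleRoot : Fin 10 → LorentzLattice :=
  ![![1, 0, 0, 0, 0], ![0, 1, 0, 0, 0], ![0, 0, 1, 0, 0], ![0, 0, 0, 1, 0],
    ![-1, -1, 0, 0, -1], ![-1, 0, -1, 0, -1], ![-1, 0, 0, -1, -1],
    ![0, -1, -1, 0, -1], ![0, -1, 0, -1, -1], ![0, 0, -1, -1, -1]]

/-- A vector in the interior of the fundamental polytope, chosen to have the same product with
all ten simple roots. -/
def basePoint : LorentzLattice := ![1, 1, 1, 1, 3]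

theorem lorentzForm_basePoint_self : lorentzForm basePoint basePoint = -5 := by
  rw [lorentzForm_apply]
  decide

variable (a : Fin 10)

theorem lorentzForm_simpleRoot_self : lorentzForm (simpleRoot a) (simpleRoot a) = 1 := by
  rw [lorentzForm_apply]
  decide +revert

theorem lorentzForm_simpleRoot_basePoint : lorentzForm (simpleRoot a) basePoint = 1 := by
  rw [lorentzForm_apply]
  decide +revert

/-- The reflection in a wall of the fundamental polytope. -/
noncomputable def simpleReflection : integralLorentzGroup :=
  lorentzReflection (simpleRoot a) (lorentzForm_simpleRoot_self a)

theorem simpleReflection_smul (x : LorentzLattice) :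
    simpleReflection a • x = x - (2 * lorentzForm (simpleRoot a) x) • simpleRoot a :=
  lorentzReflection_smul _ x

theorem simpleReflection_inv : (simpleReflection a)⁻¹ = simpleReflection a :=
  inv_eq_of_mul_eq_one_left (lorentzReflection_mul_self _)

theorem lorentzForm_simpleReflection_smul (x y : LorentzLattice) :
    lorentzForm x (simpleReflection a • y) = lorentzForm (simpleReflection a • x) y := by
  rw [lorentzForm_smul_left, simpleReflection_inv]

/-- The group generated by the reflections in the walls of the fundamental polytope. -/
def reflectionSubgroup : Subgroup integralLorentzGroup :=
  Subgroup.closure (Set.range simpleReflection)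

theorem simpleReflection_mem : simpleReflection a ∈ reflectionSubgroup :=
  Subgroup.subset_closure ⟨a, rfl⟩

theorem reflectionSubgroup_le : reflectionSubgroup ≤ congruenceSubgroup 2 :=
  (Subgroup.closure_le _).2 <| Set.range_subset_iff.2 fun _ =>
    lorentzReflection_mem_congruenceSubgroup _

end ReflectionSubgroup

section Timelike

variable {x y : LorentzLattice}

theorem sq_lorentzForm_add_mul_lt (hx : lorentzForm x x < 0) (hy : lorentzForm y y ≤ 0)
    (hy4 : y 4 ≠ 0) : (lorentzForm x y + x 4 * y 4) ^ 2 < (x 4 * y 4) ^ 2 := by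
  rw [lorentzForm_apply] at *
  have cauchySchwarz : (x 0 * y 0 + x 1 * y 1 + x 2 * y 2 + x 3 * y 3) ^ 2 ≤
      (x 0 ^ 2 + x 1 ^ 2 + x 2 ^ 2 + x 3 ^ 2) * (y 0 ^ 2 + y 1 ^ 2 + y 2 ^ 2 + y 3 ^ 2) := by
    simpa [Fin.sum_univ_four] using Finset.sum_mul_sq_le_sq_mul_sq Finset.univ
      (fun i : Fin 4 => x i.castSucc) fun i => y i.castSucc
  rw [sub_add_cancel, mul_pow]
  calc _ ≤ _ := cauchySchwarz
    _ ≤ (x 0 ^ 2 + x 1 ^ 2 + x 2 ^ 2 + x 3 ^ 2) * y 4 ^ 2 := by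
      gcongr
      linarith
    _ < x 4 ^ 2 * y 4 ^ 2 := by
      gcongr
      linarith

theorem lorentzForm_self_pos_of_orthogonal (hy : lorentzForm y y < 0) (orth : lorentzForm y x = 0)
    (hx : x ≠ 0) : 0 < lorentzForm x x := by
  by_contra! hxx
  have hx4 : x 4 ≠ 0 := fun h4 => hx <| by
    rw [lorentzForm_apply, h4] at hxx
    ext i
    fin_cases i <;> dsimp <;> nlinarith
  have := sq_lorentzForm_add_mul_lt hy hxx hx4
  rw [orth, zero_add] at this
  exact this.false

theorem lorentzForm_neg_of_pos (hx : lorentzForm x x < 0) (hy : lorentzForm y y ≤ 0)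
    (hx4 : 0 < x 4) (hy4 : 0 < y 4) : lorentzForm x y < 0 := by
  have := abs_lt_of_sq_lt_sq (sq_lorentzForm_add_mul_lt hx hy hy4.ne') (by positivity)
  linarith [(abs_lt.1 this).2]

theorem lorentzForm_mul_le_sq (hy : lorentzForm y y < 0) :
    lorentzForm x x * lorentzForm y y ≤ lorentzForm y x ^ 2 := by
  set r := lorentzForm y y • x - lorentzForm y x • y with hr
  have orth : lorentzForm y r = 0 := by
    simp only [hr, map_sub, map_smul, smul_eq_mul]
    ring
  have r_self : lorentzForm r r =
      lorentzForm y y * (lorentzForm x x * lorentzForm y y - lorentzForm y x ^ 2) := by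
    simp only [hr, map_sub, map_smul, smul_eq_mul, LinearMap.sub_apply, LinearMap.smul_apply,
      lorentzForm_comm x y]
    ring
  have r_nonneg : 0 ≤ lorentzForm r r := by
    by_cases h : r = 0
    · simp [h]
    · exact (lorentzForm_self_pos_of_orthogonal hy orth h).le
  rw [r_self] at r_nonneg
  exact sub_nonpos.1 (nonpos_of_mul_nonneg_right r_nonneg hy)

theorem eq_of_separates {n v b : LorentzLattice} (hb : lorentzForm b b = -5)
    (hn : lorentzForm n n = 1) (hv : lorentzForm v v = 1) (hnb : lorentzForm n b = 1)
    (pos : 0 < lorentzForm v b) (lt : lorentzForm v b < 2 * lorentzForm n v) : v = n := by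
  set a := lorentzForm n v with ha
  -- Both `v - a n` and the timelike vector `b - n` are orthogonal to `n`.
  have self_y : lorentzForm (b - n) (b - n) = -6 := by
    simp only [map_sub, LinearMap.sub_apply, lorentzForm_comm b n, hb, hn, hnb]
    norm_num
  have self_v' : lorentzForm (v - a • n) (v - a • n) = 1 - a ^ 2 := by
    simp only [map_sub, map_smul, LinearMap.sub_apply, LinearMap.smul_apply, smul_eq_mul,
      lorentzForm_comm v n, hv, hn, ← ha]
    ring
  have pairing : lorentzForm (b - n) (v - a • n) = lorentzForm v b - a := by
    simp only [map_sub, map_smul, LinearMap.sub_apply, smul_eq_mul, lorentzForm_comm b, hn, hnb,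
      ← ha]
    ring
  have timelike : lorentzForm (b - n) (b - n) < 0 := by rw [self_y]; norm_num
  have reverse := lorentzForm_mul_le_sq (x := v - a • n) timelike
  rw [self_y, self_v', pairing] at reverse
  have a_eq_one : a = 1 := by nlinarith
  have orth : lorentzForm (b - n) (v - a • n) = 0 := by rw [pairing]; omega
  have self_zero : lorentzForm (v - a • n) (v - a • n) = 0 := by rw [self_v', a_eq_one]; rfl
  have v'_eq_zero : v - a • n = 0 := by
    by_contra h
    exact (lorentzForm_self_pos_of_orthogonal timelike orth h).ne' self_zero
  rw [sub_eq_zero.1 v'_eq_zero, a_eq_one, one_smul]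

end Timelike

section FundamentalPolytope

theorem sum_sq_le_sq_of_pairwise_add_le {R : Type*} [CommRing R] [LinearOrder R]
    [IsStrictOrderedRing R] {y : Fin 4 → R} {s : R} (nonneg : ∀ i, 0 ≤ y i)
    (add_le : ∀ i j, i ≠ j → y i + y j ≤ s) : ∑ i, y i ^ 2 ≤ s ^ 2 := by
  obtain ⟨m, y_le⟩ := Finite.exists_max y
  have le_sub (k : Fin 3) : y (m.succAbove k) ≤ s - y m :=
    le_sub_iff_add_le.2 (add_le _ _ (m.succAbove_ne k))
  have sq_le_mul (k : Fin 3) : y (m.succAbove k) ^ 2 ≤ y m * (s - y m) := by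
    rw [sq]
    exact mul_le_mul (y_le _) (le_sub k) (nonneg _) (nonneg _)
  have sq_le_sq (k : Fin 3) : y (m.succAbove k) ^ 2 ≤ (s - y m) ^ 2 :=
    pow_le_pow_left₀ (nonneg _) (le_sub k) 2
  rw [Fin.sum_univ_succAbove _ m, Fin.sum_univ_three]
  linarith [sq_le_mul 0, sq_le_mul 1, sq_le_sq 2]

variable {x : LorentzLattice}

theorem forall_lorentzForm_simpleRoot_pos_iff :
    (∀ a, 0 < lorentzForm (simpleRoot a) x) ↔ (∀ i : Fin 4, 0 < x i.castSucc) ∧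
      ∀ i j : Fin 4, i ≠ j → x i.castSucc + x j.castSucc < x 4 := by
  simp only [Fin.forall_fin_succ, IsEmpty.forall_iff, lorentzForm_apply, simpleRoot,
    Matrix.cons_val, Matrix.cons_val_succ, Fin.reduceSucc, Fin.reduceCastSucc,
    Fin.succ_zero_eq_one, Fin.succ_one_eq_two]
  grind

theorem eq_basePoint_of_forall_pos (hx : lorentzForm x x = -5)
    (pos : ∀ a, 0 < lorentzForm (simpleRoot a) x) : x = basePoint := by
  obtain ⟨coord_pos, add_lt⟩ := forall_lorentzForm_simpleRoot_pos_iff.1 pos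
  have nonneg (i : Fin 4) : 0 ≤ x i.castSucc - 1 := Int.sub_nonneg.2 (coord_pos i)
  have add_le (i j : Fin 4) (hij : i ≠ j) : x i.castSucc - 1 + (x j.castSucc - 1) ≤ x 4 - 3 := by
    linarith [Int.add_one_le_of_lt (add_lt i j hij)]
  have sum_sq_le : (x 0 - 1) ^ 2 + (x 1 - 1) ^ 2 + (x 2 - 1) ^ 2 + (x 3 - 1) ^ 2 ≤
      (x 4 - 3) ^ 2 := by
    simpa [Fin.sum_univ_four] using sum_sq_le_sq_of_pairwise_add_le nonneg add_le
  have x4_eq : x 4 = 3 := by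
    have h₀ : 0 < x 0 := coord_pos 0
    have h₁ : 0 < x 1 := coord_pos 1
    have h₀₁ : x 0 + x 1 < x 4 := add_lt 0 1 (by decide)
    have h₂₃ : x 2 + x 3 < x 4 := add_lt 2 3 (by decide)
    rw [lorentzForm_apply] at hx
    linarith
  have coord_eq (i : Fin 4) : x i.castSucc = 1 := by
    obtain ⟨j, hj⟩ := exists_ne i
    linarith [nonneg i, nonneg j, add_le i j hj.symm]
  ext i
  induction i using Fin.lastCases with
  | last => exact x4_eq
  | cast i =>
    rw [coord_eq]
    fin_cases i <;> rfl

theorem eq_single_of_lorentzForm_eq_one {v : LorentzLattice} {k : Fin 5} (hk : k ≠ 4)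
    (self : lorentzForm v v = 1) (base : lorentzForm v basePoint = 1)
    (hmod : reduceMod 2 v = reduceMod 2 (Pi.single k 1)) : v = Pi.single k 1 := by
  rw [reduceMod_eq_iff] at hmod
  rw [lorentzForm_apply] at self base
  simp only [basePoint, Matrix.cons_val] at base
  have v4_eq : v 4 = 0 := by
    have v4_even : v 4 % 2 = 0 := by simpa [Int.ModEq, hk.symm] using hmod 4
    have : -2 < v 4 := by
      nlinarith [sq_nonneg (v 0 - v 1), sq_nonneg (v 0 - v 2), sq_nonneg (v 0 - v 3),
        sq_nonneg (v 1 - v 2), sq_nonneg (v 1 - v 3), sq_nonneg (v 2 - v 3)]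
    have : v 4 < 2 := by
      nlinarith [sq_nonneg (v 0 - v 1), sq_nonneg (v 0 - v 2), sq_nonneg (v 0 - v 3),
        sq_nonneg (v 1 - v 2), sq_nonneg (v 1 - v 3), sq_nonneg (v 2 - v 3)]
    omega
  -- The nonnegative integers `vᵢ² - vᵢ` add up to `1 - 1`.
  have sub_nonneg (i : Fin 5) : 0 ≤ v i ^ 2 - v i := sub_nonneg.2 (Int.le_self_sq _)
  have sq_eq (i : Fin 5) : v i ^ 2 = v i := by
    have v4_sq : v 4 ^ 2 = v 4 := by rw [v4_eq]; rfl
    fin_cases i <;> dsimp only [Fin.reduceFinMk] <;>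
      linarith [v4_sq, sub_nonneg 0, sub_nonneg 1, sub_nonneg 2, sub_nonneg 3]
  ext i
  have zero_or_one : v i = 0 ∨ v i = 1 := by
    rw [← sub_eq_zero (a := v i) (b := 1), ← mul_eq_zero]
    linarith [sq_eq i]
  have := hmod i
  rcases eq_or_ne i k with rfl | hik <;> grind [Int.ModEq, Pi.single_eq_same, Pi.single_eq_of_ne]

theorem eq_one_of_smul_basePoint_eq {g : integralLorentzGroup} (hg : g ∈ congruenceSubgroup 2)
    (hb : g • basePoint = basePoint) : g = 1 := by
  have fixes_spacelike (k : Fin 5) (hk : k ≠ 4) :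
      g • (Pi.single k 1 : LorentzLattice) = Pi.single k 1 := by
    refine eq_single_of_lorentzForm_eq_one hk ?_ ?_ (mem_congruenceSubgroup_iff.1 hg _)
    · rw [lorentzForm_smul_smul, lorentzForm_apply]
      decide +revert
    · rw [← hb, lorentzForm_smul_smul, lorentzForm_apply]
      decide +revert
  have basePoint_eq : basePoint = Pi.single 0 1 + Pi.single 1 1 + Pi.single 2 1 + Pi.single 3 1 +
      (3 : ℤ) • Pi.single 4 1 := by decide
  refine integralLorentzGroup.eq_of_smul_single_eq fun i => ?_
  rw [one_smul]
  by_cases hi : i = 4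
  · subst hi
    rw [basePoint_eq, smul_add, smul_add, smul_add, smul_add, fixes_spacelike 0 (by decide),
      fixes_spacelike 1 (by decide), fixes_spacelike 2 (by decide), fixes_spacelike 3 (by decide),
      add_right_inj, smul_comm] at hb
    exact smul_right_injective _ three_ne_zero hb
  · exact fixes_spacelike i hi

end FundamentalPolytope

section Generation

variable {x : LorentzLattice}

theorem lorentzReflection_smul_time_pos {n : LorentzLattice} (hn : lorentzForm n n = 1)
    (hx : lorentzForm x x < 0) (hx4 : 0 < x 4) : 0 < (lorentzReflection n hn • x) 4 := by
  have time_eq (v : LorentzLattice) : v 4 = -lorentzForm v (Pi.single 4 1) := by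
    simp [lorentzForm_apply]
  set e : LorentzLattice := Pi.single 4 1 with he
  set e' := lorentzReflection n hn • e with he'
  have e'_time : 0 < e' 4 := by
    have : e' 4 = 1 + 2 * n 4 ^ 2 := by
      simp only [he', he, lorentzReflection_smul, lorentzForm_apply, Pi.sub_apply, Pi.smul_apply,
        Pi.single_eq_same, ne_eq, Fin.reduceEq, not_false_eq_true, Pi.single_eq_of_ne, smul_eq_mul]
      ring
    rw [this]
    positivity
  have e'_self : lorentzForm e' e' ≤ 0 := by
    rw [lorentzForm_smul_smul, lorentzForm_apply]
    decide
  rw [time_eq (_ • x), lorentzForm_smul_left,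
    inv_eq_of_mul_eq_one_left (lorentzReflection_mul_self hn)]
  exact neg_pos.2 (lorentzForm_neg_of_pos hx e'_self hx4 e'_time)

theorem lorentzForm_smul_basePoint_self (g : integralLorentzGroup) :
    lorentzForm (g • basePoint) (g • basePoint) = -5 := by
  rw [lorentzForm_smul_smul, lorentzForm_basePoint_self]

theorem odd_lorentzForm_smul_basePoint {v : LorentzLattice} (hv : lorentzForm v v = 1)
    (g : integralLorentzGroup) : Odd (lorentzForm v (g • basePoint)) := by
  obtain ⟨w, rfl⟩ : ∃ w, g • w = v := ⟨g⁻¹ • v, smul_inv_smul g v⟩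
  rw [lorentzForm_smul_smul] at hv ⊢
  have coordinate_parity (i : Fin 5) : Even (w i * (w i - 1)) := Int.even_mul_pred_self _
  have := coordinate_parity 0; have := coordinate_parity 1; have := coordinate_parity 2
  have := coordinate_parity 3; have := coordinate_parity 4
  simp only [lorentzForm_apply, basePoint, Matrix.cons_val] at *
  grind

theorem mem_reflectionSubgroup_of_time_pos {g : integralLorentzGroup}
    (hg : g ∈ congruenceSubgroup 2) (pos : 0 < (g • basePoint) 4) : g ∈ reflectionSubgroup := by
  induction hk : (-lorentzForm (g • basePoint) basePoint).toNat using Nat.strong_induction_on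
    generalizing g with | _ k descend
  subst hk
  have self := lorentzForm_smul_basePoint_self g
  by_cases interior : ∀ a, 0 < lorentzForm (simpleRoot a) (g • basePoint)
  · rw [eq_one_of_smul_basePoint_eq hg (eq_basePoint_of_forall_pos self interior)]
    exact one_mem _
  obtain ⟨a, ha⟩ := not_forall.1 interior
  have height : lorentzForm ((simpleReflection a * g) • basePoint) basePoint =
      lorentzForm (g • basePoint) basePoint - 2 * lorentzForm (simpleRoot a) (g • basePoint) := by
    simp only [mul_smul, simpleReflection_smul, map_sub, map_smul, LinearMap.sub_apply,
      LinearMap.smul_apply, lorentzForm_simpleRoot_basePoint, smul_eq_mul, mul_one]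
  have time_pos : 0 < ((simpleReflection a * g) • basePoint) 4 := by
    rw [mul_smul]
    exact lorentzReflection_smul_time_pos _ (by rw [self]; decide) pos
  have height_neg : lorentzForm ((simpleReflection a * g) • basePoint) basePoint < 0 :=
    lorentzForm_neg_of_pos (by rw [lorentzForm_smul_basePoint_self]; decide)
      (by rw [lorentzForm_basePoint_self]; decide) time_pos (by decide)
  have := odd_lorentzForm_smul_basePoint (lorentzForm_simpleRoot_self a) g
  rw [← reflectionSubgroup.mul_mem_cancel_left (simpleReflection_mem a)]
  refine descend _ ?_ (mul_mem (reflectionSubgroup_le (simpleReflection_mem a)) hg) time_pos rfl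
  grind

theorem mem_reflectionSubgroup_or_lorentzNegOne_mul_mem {g : integralLorentzGroup}
    (hg : g ∈ congruenceSubgroup 2) :
    g ∈ reflectionSubgroup ∨ lorentzNegOne * g ∈ reflectionSubgroup := by
  rcases lt_trichotomy 0 ((g • basePoint) 4) with pos | zero | neg
  · exact .inl (mem_reflectionSubgroup_of_time_pos hg pos)
  · have self := lorentzForm_smul_basePoint_self g
    rw [lorentzForm_apply, ← zero] at self
    nlinarith
  · refine .inr (mem_reflectionSubgroup_of_time_pos
      (mul_mem lorentzNegOne_mem_congruenceSubgroup hg) ?_)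
    rw [mul_smul, lorentzNegOne_smul]
    exact neg_pos.2 neg

end Generation

section SignCharacter

theorem reduceMod_mul_smul_sub {N : ℕ} {g h : integralLorentzGroup}
    (hg : g ∈ congruenceSubgroup N) (hh : h ∈ congruenceSubgroup N) (v : LorentzLattice) :
    reduceMod (N * N) ((g * h) • v - v) = reduceMod (N * N) ((g • v - v) + (h • v - v)) := by
  obtain ⟨w, hw⟩ : ∃ w : LorentzLattice, h • v - v = (N : ℤ) • w := by
    choose w hw using fun i =>
      (reduceMod_eq_iff.1 (mem_congruenceSubgroup_iff.1 hh v) i).symm.dvd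
    exact ⟨w, funext hw⟩
  have split : (g * h) • v - v = (g • v - v) + (h • v - v) + (N : ℤ) • (g • w - w) := by
    rw [smul_sub, smul_comm (N : ℤ) g w, ← hw, smul_sub, mul_smul]
    abel
  have displaced_w (i : Fin 5) : (N : ℤ) ∣ (g • w - w) i :=
    (reduceMod_eq_iff.1 (mem_congruenceSubgroup_iff.1 hg w) i).symm.dvd
  rw [reduceMod_eq_iff]
  intro i
  rw [split, Pi.add_apply]
  refine Int.modEq_iff_dvd.2 ?_
  rw [sub_add_cancel_left, dvd_neg]
  push_cast
  exact mul_dvd_mul_left _ (displaced_w i)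

/-- The coefficients `uₖ` of the linear functional `M ↦ ∑ₖ B(uₖ, M eₖ)` on matrices whose value on
`n ⊗ B(n, ·)` is the quadratic form `∑_{i<j<4} nᵢnⱼ + n₄²`; this form is even on every simple
root. -/
def signWeight : Fin 5 → LorentzLattice :=
  ![![0, 1, 1, 1, 0], ![0, 0, 1, 1, 0], ![0, 0, 0, 1, 0], 0, ![0, 0, 0, 0, 1]]

/-- The functional with coefficients `signWeight` applied to `g - 1`. -/
def signSum (g : integralLorentzGroup) : ℤ :=
  ∑ k, lorentzForm (signWeight k) (g • (Pi.single k 1 : LorentzLattice) - Pi.single k 1)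

theorem signSum_mul_modEq {g h : integralLorentzGroup} (hg : g ∈ congruenceSubgroup 2)
    (hh : h ∈ congruenceSubgroup 2) : signSum (g * h) ≡ signSum g + signSum h [ZMOD 4] := by
  simp only [signSum, ← Finset.sum_add_distrib, ← map_add]
  exact Int.ModEq.sum fun k _ => lorentzForm_modEq rfl (reduceMod_mul_smul_sub hg hh _)

theorem signSum_simpleReflection_modEq (a : Fin 10) :
    signSum (simpleReflection a) ≡ 0 [ZMOD 4] := by
  have even : 2 ∣ ∑ k, lorentzForm (simpleRoot a) (Pi.single k 1) *
      lorentzForm (signWeight k) (simpleRoot a) := by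
    simp only [lorentzForm_apply]
    decide +revert
  obtain ⟨q, hq⟩ := even
  have sum_eq : signSum (simpleReflection a) = 4 * -q := by
    simp only [signSum, simpleReflection_smul, sub_sub_cancel_left, map_neg, map_smul,
      smul_eq_mul, mul_assoc, Finset.sum_neg_distrib, ← Finset.mul_sum, hq]
    ring
  exact Int.modEq_zero_iff_dvd.2 ⟨-q, sum_eq⟩

theorem signSum_modEq_of_mem_congruenceSubgroup {g : integralLorentzGroup}
    (hg : g ∈ congruenceSubgroup 4) : signSum g ≡ 0 [ZMOD 4] := by
  have term_modEq (k : Fin 5) : lorentzForm (signWeight k)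
      (g • (Pi.single k 1 : LorentzLattice) - Pi.single k 1) ≡ 0 [ZMOD 4] := by
    rw [← map_zero (lorentzForm (signWeight k))]
    refine lorentzForm_modEq (N := 4) rfl ?_
    rw [map_sub, map_zero, sub_eq_zero]
    exact mem_congruenceSubgroup_iff.1 hg _
  exact (Int.ModEq.sum fun k _ => term_modEq k).trans (by simp)

theorem signSum_lorentzNegOne : signSum lorentzNegOne = 2 := by
  simp only [signSum, lorentzNegOne_smul, lorentzForm_apply]
  decide

/-- The homomorphism `Γ(2) → ℤ/4` given by `signSum`. It is trivial on the simple reflections and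
on `Γ(4)` but not at `-1`. -/
def signCharacter : congruenceSubgroup 2 →* Multiplicative (ZMod 4) :=
  MonoidHom.mk' (fun g => .ofAdd (signSum g : ZMod 4)) fun g h => by
    rw [← ofAdd_add, ← Int.cast_add]
    exact congrArg _ ((ZMod.intCast_eq_intCast_iff _ _ 4).2 (signSum_mul_modEq g.2 h.2))

theorem signCharacter_eq_one_iff {g : congruenceSubgroup 2} :
    signCharacter g = 1 ↔ signSum g ≡ 0 [ZMOD 4] := by
  have := ZMod.intCast_eq_intCast_iff (signSum g) 0 4
  rw [Int.cast_zero] at this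
  exact this

theorem signSum_modEq_of_mem_reflectionSubgroup {g : integralLorentzGroup}
    (hg : g ∈ reflectionSubgroup) : signSum g ≡ 0 [ZMOD 4] := by
  have le : reflectionSubgroup ≤ signCharacter.ker.map (congruenceSubgroup 2).subtype := by
    rw [reflectionSubgroup, Subgroup.closure_le, Set.range_subset_iff]
    exact fun a => ⟨⟨_, reflectionSubgroup_le (simpleReflection_mem a)⟩,
      signCharacter_eq_one_iff.2 (signSum_simpleReflection_modEq a), rfl⟩
  obtain ⟨h, hh, rfl⟩ := le hg
  exact signCharacter_eq_one_iff.1 hh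

theorem congruenceSubgroup_four_le_reflectionSubgroup :
    congruenceSubgroup 4 ≤ reflectionSubgroup := by
  intro g hg
  have hg₂ : g ∈ congruenceSubgroup 2 := congruenceSubgroup_le_of_dvd (by decide) hg
  refine (mem_reflectionSubgroup_or_lorentzNegOne_mul_mem hg₂).resolve_right fun h => ?_
  have two_modEq : 2 + 0 ≡ 0 [ZMOD 4] := calc
    2 + 0 ≡ signSum lorentzNegOne + signSum g [ZMOD 4] :=
      signSum_lorentzNegOne ▸ (signSum_modEq_of_mem_congruenceSubgroup hg).symm.add_left _
    _ ≡ signSum (lorentzNegOne * g) [ZMOD 4] :=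
      (signSum_mul_modEq lorentzNegOne_mem_congruenceSubgroup hg₂).symm
    _ ≡ 0 [ZMOD 4] := signSum_modEq_of_mem_reflectionSubgroup h
  exact absurd two_modEq (by decide)

end SignCharacter

theorem congruenceSubgroup_fg {N : ℕ} [NeZero N] (hN : 4 ∣ N) :
    Group.FG (congruenceSubgroup N) := by
  have le : congruenceSubgroup N ≤ reflectionSubgroup :=
    (congruenceSubgroup_le_of_dvd hN).trans congruenceSubgroup_four_le_reflectionSubgroup
  have : Group.FG reflectionSubgroup :=
    (Group.fg_iff_subgroup_fg _).2 ((Subgroup.fg_iff _).2 ⟨_, rfl, Set.finite_range _⟩)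
  have := Subgroup.fg_of_index_ne_zero ((congruenceSubgroup N).subgroupOf reflectionSubgroup)
  exact Group.fg_of_surjective (f := (Subgroup.subgroupOfEquivOfLe le).toMonoidHom)
    (Subgroup.subgroupOfEquivOfLe le).surjective

section WallCrossing

variable (p q r v : LorentzLattice)

/-- The signed crossing number of a path from `p` to `q` with the wall `v^⊥`: it is `1` if the
path enters the half-space `B(v, ·) > 0`, `-1` if it leaves it, and `0` if it does neither or if
`v` is not a unit vector. -/
def wallCrossing : ℤ :=
  if lorentzForm v v = 1 then
    (if 0 < lorentzForm v q then 1 else 0) - (if 0 < lorentzForm v p then 1 else 0)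
  else 0

theorem wallCrossing_self : wallCrossing p p v = 0 := by
  simp [wallCrossing]

theorem wallCrossing_add_wallCrossing :
    wallCrossing p q v + wallCrossing q r v = wallCrossing p r v := by
  simp only [wallCrossing]
  split_ifs <;> rfl

theorem wallCrossing_smul_smul (g : integralLorentzGroup) :
    wallCrossing (g • p) (g • q) v = wallCrossing p q (g⁻¹ • v) := by
  simp only [wallCrossing, lorentzForm_smul_left, inv_inv, smul_inv_smul]

theorem wallCrossing_basePoint_neg (g : integralLorentzGroup) :
    wallCrossing basePoint (g • basePoint) (-v) = -wallCrossing basePoint (g • basePoint) v := by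
  have ne_zero (hv : lorentzForm v v = 1) (h : integralLorentzGroup) :
      lorentzForm v (h • basePoint) ≠ 0 := fun h0 => by
    simpa [h0] using odd_lorentzForm_smul_basePoint hv h
  simp only [wallCrossing, map_neg, LinearMap.neg_apply, neg_neg]
  by_cases hv : lorentzForm v v = 1
  · have base_ne_zero := ne_zero hv 1
    rw [one_smul] at base_ne_zero
    have := ne_zero hv g
    grind
  · simp [hv]

theorem wallCrossing_basePoint_mul (g h : integralLorentzGroup) :
    wallCrossing basePoint ((g * h) • basePoint) v = wallCrossing basePoint (g • basePoint) v +
      wallCrossing basePoint (h • basePoint) (g⁻¹ • v) := by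
  rw [← wallCrossing_add_wallCrossing _ (g • basePoint), mul_smul, wallCrossing_smul_smul]

theorem wallCrossing_simpleReflection_self (a : Fin 10) :
    wallCrossing basePoint (simpleReflection a • basePoint) (simpleRoot a) = -1 := by
  have flipped : lorentzForm (simpleRoot a) (simpleReflection a • basePoint) = -1 := by
    rw [lorentzForm_simpleReflection_smul, simpleReflection, lorentzReflection_smul_self, map_neg,
      LinearMap.neg_apply, lorentzForm_simpleRoot_basePoint]
  simp [wallCrossing, flipped, lorentzForm_simpleRoot_self, lorentzForm_simpleRoot_basePoint]

theorem wallCrossing_simpleReflection_eq_zero {a : Fin 10} {v : LorentzLattice}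
    (ne : v ≠ simpleRoot a) (ne_neg : v ≠ -simpleRoot a) :
    wallCrossing basePoint (simpleReflection a • basePoint) v = 0 := by
  by_cases hv : lorentzForm v v = 1
  swap
  · exact if_neg hv
  have not_separates {w : LorentzLattice} (hw : lorentzForm w w = 1) (hne : w ≠ simpleRoot a) :
      ¬(0 < lorentzForm w basePoint ∧
        lorentzForm w basePoint < 2 * lorentzForm (simpleRoot a) w) :=
    fun h => hne <| eq_of_separates lorentzForm_basePoint_self (lorentzForm_simpleRoot_self a) hw
      (lorentzForm_simpleRoot_basePoint a) h.1 h.2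
  have not_leaving := not_separates hv ne
  have not_entering :=
    not_separates (w := -v) (by simpa using hv) (by rwa [ne_eq, neg_eq_iff_eq_neg])
  have base_odd := odd_lorentzForm_smul_basePoint hv 1
  have image : lorentzForm v (simpleReflection a • basePoint) =
      lorentzForm v basePoint - 2 * lorentzForm (simpleRoot a) v := by
    rw [simpleReflection_smul, map_sub, map_smul, lorentzForm_simpleRoot_basePoint,
      lorentzForm_comm v (simpleRoot a), mul_one, smul_eq_mul]
  rw [one_smul] at base_odd
  simp only [map_neg, LinearMap.neg_apply] at not_entering
  simp only [wallCrossing, image]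
  grind

theorem wallCrossing_simpleReflection (a : Fin 10) :
    wallCrossing basePoint (simpleReflection a • basePoint) =
      (Finsupp.single (-simpleRoot a) 1 - Finsupp.single (simpleRoot a) 1 :
        LorentzLattice →₀ ℤ) := by
  have root_ne_neg : simpleRoot a ≠ -simpleRoot a := by decide +revert
  ext v
  rw [Finsupp.sub_apply]
  by_cases pos : v = simpleRoot a
  · simp [pos, wallCrossing_simpleReflection_self, Finsupp.single_eq_of_ne root_ne_neg]
  by_cases neg : v = -simpleRoot a
  · simp [neg, wallCrossing_basePoint_neg, wallCrossing_simpleReflection_self,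
      Finsupp.single_eq_of_ne root_ne_neg.symm]
  · simp [wallCrossing_simpleReflection_eq_zero pos neg, Finsupp.single_eq_of_ne pos,
      Finsupp.single_eq_of_ne neg]

theorem hasFiniteSupport_wallCrossing {g : integralLorentzGroup} (hg : g ∈ reflectionSubgroup) :
    (wallCrossing basePoint (g • basePoint)).HasFiniteSupport := by
  induction hg using Subgroup.closure_induction with
  | mem _ h =>
    obtain ⟨a, rfl⟩ := h
    rw [wallCrossing_simpleReflection]
    exact Finsupp.hasFiniteSupport _
  | one => simp [Function.HasFiniteSupport, Function.support, wallCrossing_self]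
  | mul g h _ _ finite_g finite_h =>
    rw [funext fun v => wallCrossing_basePoint_mul v g h]
    exact finite_g.add (finite_h.comp_of_injective (MulAction.injective g⁻¹))
  | inv g _ finite_g =>
    have inv_eq (v : LorentzLattice) : wallCrossing basePoint (g⁻¹ • basePoint) v =
        -wallCrossing basePoint (g • basePoint) (g • v) := by
      have := wallCrossing_basePoint_mul v g⁻¹ g
      rw [inv_mul_cancel, one_smul, wallCrossing_self, inv_inv] at this
      exact eq_neg_of_add_eq_zero_left this.symm
    rw [funext inv_eq]
    exact (finite_g.comp_of_injective (MulAction.injective g)).neg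

end WallCrossing

theorem eq_of_isCocycle₁_of_eqOn {G A : Type*} [Group G] [AddCommGroup A] [DistribMulAction G A]
    {f f' : G → A} (hf : groupCohomology.IsCocycle₁ f) (hf' : groupCohomology.IsCocycle₁ f')
    {s : Set G} (hs : Subgroup.closure s = ⊤) (eqOn : s.EqOn f f') : f = f' := by
  funext g
  have hg : g ∈ Subgroup.closure s := hs ▸ Subgroup.mem_top g
  induction hg using Subgroup.closure_induction with
  | mem g hg => exact eqOn hg
  | one =>
    rw [groupCohomology.map_one_of_isCocycle₁ hf, groupCohomology.map_one_of_isCocycle₁ hf']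
  | mul g h _ _ eq_g eq_h => rw [hf, hf', eq_g, eq_h]
  | inv g _ eq_g =>
    apply MulAction.injective g
    dsimp only
    rw [groupCohomology.map_inv_of_isCocycle₁ hf, groupCohomology.map_inv_of_isCocycle₁ hf', eq_g]

section CrossingChain

/-- The walls crossed on the way from the base point to its image under `g`, counted with sign. -/
noncomputable def crossingChain (g : reflectionSubgroup) : LorentzLattice →₀ ℤ :=
  .ofSupportFinite (wallCrossing basePoint (g • basePoint)) (hasFiniteSupport_wallCrossing g.2)

theorem crossingChain_mul (g h : reflectionSubgroup) :
    crossingChain (g * h) = crossingChain g + (crossingChain h).mapDomain (g • ·) := by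
  ext v
  obtain ⟨w, rfl⟩ : ∃ w, g • w = v := ⟨g⁻¹ • v, smul_inv_smul g v⟩
  rw [Finsupp.add_apply, Finsupp.mapDomain_apply (MulAction.injective g)]
  refine (wallCrossing_basePoint_mul _ g.1 h.1).trans ?_
  exact congrArg (_ + crossingChain h ·) (inv_smul_smul g w)

theorem crossingChain_simpleReflection (a : Fin 10) :
    crossingChain ⟨simpleReflection a, simpleReflection_mem a⟩ =
      Finsupp.single (-simpleRoot a) 1 - Finsupp.single (simpleRoot a) 1 :=
  DFunLike.coe_injective (wallCrossing_simpleReflection a)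

/-- For a unit vector `v` in the `Γ(2)`-orbit of a simple root, this is the simple root in that
orbit up to sign: the simple roots are determined by their residues modulo two. -/
def wallType (v : LorentzLattice) : LorentzLattice := fun k => (1 - 2 * (v 4 % 2)) * (v k % 2)

theorem wallType_eq_of_reduceMod_eq {v w : LorentzLattice} (h : reduceMod 2 v = reduceMod 2 w) :
    wallType v = wallType w := by
  rw [reduceMod_eq_iff] at h
  funext k
  exact congrArg₂ (fun m n => (1 - 2 * m) * n) (h 4) (h k)

theorem wallType_neg (v : LorentzLattice) : wallType (-v) = wallType v :=
  wallType_eq_of_reduceMod_eq <| reduceMod_eq_iff.2 fun i =>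
    Int.modEq_iff_add_fac.2 ⟨v i, by simp; ring⟩

theorem wallType_smul {g : integralLorentzGroup} (hg : g ∈ congruenceSubgroup 2)
    (v : LorentzLattice) : wallType (g • v) = wallType v :=
  wallType_eq_of_reduceMod_eq (mem_congruenceSubgroup_iff.1 hg v)

theorem wallType_simpleRoot (a : Fin 10) : wallType (simpleRoot a) = simpleRoot a := by
  decide +revert

/-- The contribution of a crossing of the wall `v^⊥` to the displacement of `y`. -/
def wallDisplacement (y v : LorentzLattice) : LorentzLattice := lorentzForm (wallType v) y • v

theorem wallDisplacement_odd (y : LorentzLattice) : Function.Odd (wallDisplacement y) := fun v => by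
  rw [wallDisplacement, wallDisplacement, wallType_neg, smul_neg]

theorem wallDisplacement_smul {g : integralLorentzGroup} (hg : g ∈ congruenceSubgroup 2)
    (y v : LorentzLattice) : wallDisplacement y (g • v) = g • wallDisplacement y v := by
  rw [wallDisplacement, wallDisplacement, wallType_smul hg, smul_comm]

theorem wallDisplacement_simpleRoot (a : Fin 10) (y : LorentzLattice) :
    wallDisplacement y (simpleRoot a) = lorentzForm (simpleRoot a) y • simpleRoot a := by
  rw [wallDisplacement, wallType_simpleRoot]

theorem linearCombination_crossingChain (y : LorentzLattice) (g : reflectionSubgroup) :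
    Finsupp.linearCombination ℤ (wallDisplacement y) (crossingChain g) =
      g • y - y := by
  have displacement_cocycle :
      groupCohomology.IsCocycle₁ fun g : reflectionSubgroup => g • y - y := fun g h => by
    dsimp only
    rw [mul_smul, smul_sub]
    abel
  have crossing_cocycle : groupCohomology.IsCocycle₁ fun g : reflectionSubgroup =>
      Finsupp.linearCombination ℤ (wallDisplacement y) (crossingChain g) := by
    intro g h
    have translate : wallDisplacement y ∘ (g • ·) =
        DistribSMul.toLinearMap ℤ LorentzLattice g ∘ wallDisplacement y :=
      funext (wallDisplacement_smul (reflectionSubgroup_le g.2) y)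
    dsimp only
    rw [crossingChain_mul, map_add, Finsupp.linearCombination_mapDomain, add_comm, translate,
      ← Finsupp.apply_linearCombination, DistribSMul.toLinearMap_apply]
  refine congrFun (eq_of_isCocycle₁_of_eqOn crossing_cocycle displacement_cocycle
    (Subgroup.closure_closure_coe_preimage (k := Set.range simpleReflection)) ?_) g
  rintro ⟨_, hg⟩ ⟨a, rfl⟩
  change _ = simpleReflection a • y - y
  dsimp only
  rw [crossingChain_simpleReflection, map_sub, Finsupp.linearCombination_single,
    Finsupp.linearCombination_single, wallDisplacement_odd,
    wallDisplacement_simpleRoot, simpleReflection_smul]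
  module

end CrossingChain

theorem mem_rationalCommutator_iff {G : Type*} [Group G] {g : G} :
    g ∈ rationalCommutator G ↔ Additive.ofMul (Abelianization.of g) ⊗ₜ[ℤ] (1 : ℚ) = 0 :=
  Iff.rfl

theorem map_rationalCommutator_le {G H : Type*} [Group G] [Group H] (f : G →* H) :
    (rationalCommutator G).map f ≤ rationalCommutator H := by
  rintro _ ⟨g, hg, rfl⟩
  rw [SetLike.mem_coe, mem_rationalCommutator_iff] at hg
  have image_eq_zero := congrArg ((Abelianization.map f).toAdditive.toIntLinearMap.rTensor ℚ) hg
  rwa [map_zero] at image_eq_zero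

theorem rationalCommutator_le_ker {G A : Type*} [Group G] [CommGroup A] [IsMulTorsionFree A]
    (φ : G →* A) : rationalCommutator G ≤ φ.ker := by
  intro g hg
  have tmul_one_injective : Function.Injective fun a : Additive A => a ⊗ₜ[ℤ] (1 : ℚ) := by
    convert (Module.Flat.lTensor_preserves_injective_linearMap (M := Additive A)
      (Algebra.linearMap ℤ ℚ) Int.cast_injective).comp
        (TensorProduct.rid ℤ (Additive A)).symm.injective
    simp
  rw [mem_rationalCommutator_iff] at hg
  have image_eq_zero := congrArg ((Abelianization.lift φ).toAdditive.toIntLinearMap.rTensor ℚ) hg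
  exact tmul_one_injective <| image_eq_zero.trans <|
    (map_zero _).trans (TensorProduct.zero_tmul _ _).symm

theorem linearCombination_eq_zero_of_mapDomain_eq_zero {R V C M : Type*} [Semiring R]
    [AddCommMonoid M] [Module R M] {F : V → M} {r : V → C} (hF : F.FactorsThrough r)
    {κ : V →₀ R} (hκ : κ.mapDomain r = 0) : Finsupp.linearCombination R F κ = 0 := by
  obtain ⟨G, rfl⟩ := (Function.factorsThrough_iff F).1 hF
  rw [← Finsupp.linearCombination_mapDomain, hκ, map_zero]

theorem linearCombination_eq_two_nsmul_indicator {R V M : Type*} [Ring R] [InvolutiveNeg V]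
    [AddCommGroup M] [Module R M] {κ : V →₀ R} (hκ : Function.Odd κ) {F : V → M}
    (hF : Function.Odd F) {S : Set V} (hS : ∀ v, κ v ≠ 0 → (-v ∈ S ↔ v ∉ S)) :
    Finsupp.linearCombination R F κ = 2 • Finsupp.linearCombination R (S.indicator F) κ := by
  classical
  have mapDomain_neg : κ.mapDomain Neg.neg = -κ := by
    ext v
    rw [← neg_neg v, Finsupp.mapDomain_apply neg_injective, Finsupp.neg_apply, hκ, neg_neg]
  have F_eq {v : V} (hv : κ v ≠ 0) : F v = S.indicator F v - S.indicator F (-v) := by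
    by_cases hvS : v ∈ S <;> simp [hvS, hS v hv, hF v]
  calc Finsupp.linearCombination R F κ
      = Finsupp.linearCombination R (S.indicator F - S.indicator F ∘ Neg.neg) κ :=
        Finsupp.sum_congr fun v hv => congrArg (κ v • ·) (F_eq (Finsupp.mem_support_iff.1 hv))
    _ = Finsupp.linearCombination R (S.indicator F) κ -
          Finsupp.linearCombination R (S.indicator F) (κ.mapDomain Neg.neg) := by
        rw [Finsupp.linearCombination_mapDomain]
        simp only [Finsupp.linearCombination_apply, Pi.sub_apply, smul_sub, Finsupp.sum_sub]
    _ = _ := by rw [mapDomain_neg, map_neg, sub_neg_eq_add, two_nsmul]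

theorem crossingChain_odd (g : reflectionSubgroup) : Function.Odd (crossingChain g) :=
  fun v => wallCrossing_basePoint_neg v g.1

theorem lorentzForm_self_of_crossingChain_ne_zero {g : reflectionSubgroup} {v : LorentzLattice}
    (hv : crossingChain g v ≠ 0) : lorentzForm v v = 1 :=
  by_contra fun h => hv (if_neg h)

/-- A set of vectors containing exactly one of each pair `v`, `-v` of unit vectors and described by
a congruence. -/
def congruencePositive : Set LorentzLattice := {v | lorentzForm v basePoint ≡ 1 [ZMOD 4]}

theorem neg_mem_congruencePositive_iff {v : LorentzLattice} (hv : lorentzForm v v = 1) :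
    -v ∈ congruencePositive ↔ v ∉ congruencePositive := by
  have base_odd := odd_lorentzForm_smul_basePoint hv 1
  rw [one_smul] at base_odd
  simp only [congruencePositive, Set.mem_ofPred_eq, map_neg, LinearMap.neg_apply, Int.ModEq]
  grind

theorem mem_congruencePositive_iff_of_reduceMod_eq {v w : LorentzLattice}
    (h : reduceMod 4 v = reduceMod 4 w) : v ∈ congruencePositive ↔ w ∈ congruencePositive :=
  have modEq : lorentzForm v basePoint ≡ lorentzForm w basePoint [ZMOD 4] :=
    lorentzForm_modEq h rfl
  ⟨modEq.symm.trans, modEq.trans⟩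

section ClassCrossing

variable {N : ℕ}

theorem factorsThrough_reduceMod_indicator (hN : 4 ∣ N) (y : LorentzLattice) :
    (reduceMod N ∘ congruencePositive.indicator (wallDisplacement y)).FactorsThrough
      (reduceMod N) := by
  intro v w h
  have type_eq : wallType v = wallType w :=
    wallType_eq_of_reduceMod_eq (reduceMod_eq_of_dvd ((by decide : 2 ∣ 4).trans hN) h)
  have mem_iff := mem_congruencePositive_iff_of_reduceMod_eq (reduceMod_eq_of_dvd hN h)
  by_cases hw : w ∈ congruencePositive
  · simp only [Function.comp_apply, Set.indicator_of_mem hw, Set.indicator_of_mem (mem_iff.2 hw),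
      wallDisplacement, map_smul, h, type_eq]
  · simp only [Function.comp_apply, Set.indicator_of_notMem hw,
      Set.indicator_of_notMem (mt mem_iff.1 hw)]

theorem mem_congruenceSubgroup_two_mul (hN : 4 ∣ N) {g : reflectionSubgroup}
    (hg : (crossingChain g).mapDomain (reduceMod N) = 0) : g.1 ∈ congruenceSubgroup (2 * N) := by
  rw [mem_congruenceSubgroup_iff]
  intro y
  let half := Finsupp.linearCombination ℤ (congruencePositive.indicator (wallDisplacement y))
    (crossingChain g)
  have displacement : g • y - y = 2 • half :=
    (linearCombination_crossingChain y g).symm.trans <|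
      linearCombination_eq_two_nsmul_indicator (crossingChain_odd g)
        (wallDisplacement_odd y) fun v hv => neg_mem_congruencePositive_iff <|
          lorentzForm_self_of_crossingChain_ne_zero hv
  have half_eq_zero : reduceMod N half = reduceMod N 0 := by
    rw [Finsupp.apply_linearCombination, map_zero]
    exact linearCombination_eq_zero_of_mapDomain_eq_zero
      (factorsThrough_reduceMod_indicator hN y) hg
  refine reduceMod_eq_iff.2 fun i => ?_
  calc (g • y) i = y i + 2 * half i := by
        rw [sub_eq_iff_eq_add'.1 displacement, Pi.add_apply, Pi.smul_apply, nsmul_eq_mul,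
          Nat.cast_ofNat]
    _ ≡ y i + 2 * 0 [ZMOD ↑(2 * N)] := by
        rw [Nat.cast_mul]
        exact (reduceMod_eq_iff.1 half_eq_zero i).mul_left'.add_left _
    _ = y i := by rw [mul_zero, add_zero]

/-- The crossing chain modulo `N`, which is additive on `Γ(N)`. -/
noncomputable def classCrossing (hN : congruenceSubgroup N ≤ reflectionSubgroup) :
    congruenceSubgroup N →* Multiplicative ((Fin 5 → ZMod N) →₀ ℤ) :=
  .mk' (fun g => .ofAdd ((crossingChain (Subgroup.inclusion hN g)).mapDomain (reduceMod N)))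
    fun g h => by
      have reduce_smul : reduceMod N ∘ (Subgroup.inclusion hN g • ·) = reduceMod N :=
        funext (mem_congruenceSubgroup_iff.1 g.2)
      rw [← ofAdd_add, map_mul, crossingChain_mul, Finsupp.mapDomain_add,
        ← Finsupp.mapDomain_comp, reduce_smul]

theorem map_rationalCommutator_le_congruenceSubgroup_two_mul (hN : 4 ∣ N) :
    (rationalCommutator (congruenceSubgroup N)).map (congruenceSubgroup N).subtype ≤
      congruenceSubgroup (2 * N) := by
  rintro _ ⟨g, hg, rfl⟩
  have le : congruenceSubgroup N ≤ reflectionSubgroup :=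
    (congruenceSubgroup_le_of_dvd hN).trans congruenceSubgroup_four_le_reflectionSubgroup
  exact mem_congruenceSubgroup_two_mul hN (rationalCommutator_le_ker (classCrossing le) hg)

end ClassCrossing

section CongruenceTower

variable (N : ℕ)

/-- The subgroups `Γ(2^j N)` of `Γ(N)`. -/
def congruenceTower (j : ℕ) : Subgroup (congruenceSubgroup N) :=
  (congruenceSubgroup (2 ^ j * N)).subgroupOf (congruenceSubgroup N)

theorem iInf_congruenceTower : ⨅ j, congruenceTower N j = ⊥ := by
  refine eq_bot_iff.2 fun g hg => Subtype.ext <|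
    integralLorentzGroup.eq_of_smul_single_eq fun i => funext fun k => ?_
  have two_pow_dvd (j : ℕ) : (2 : ℤ) ^ j ∣ (Pi.single i 1 : LorentzLattice) k -
      (g.1 • (Pi.single i 1 : LorentzLattice)) k := by
    have mem := congruenceSubgroup_le_of_dvd (dvd_mul_right (2 ^ j) N) (Subgroup.mem_iInf.1 hg j)
    exact_mod_cast (reduceMod_eq_iff.1 (mem_congruenceSubgroup_iff.1 mem _) k).dvd
  rw [← FiniteMultiplicity.not_iff_forall, Int.finiteMultiplicity_iff] at two_pow_dvd
  exact (sub_eq_zero.1 (by_contra fun ne => two_pow_dvd ⟨by decide, ne⟩)).symm.trans (by simp)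

theorem isRFRSTower_congruenceTower [NeZero N] (hN : 4 ∣ N) : IsRFRSTower (congruenceTower N) where
  fg := congruenceSubgroup_fg hN
  zero := by rw [congruenceTower, pow_zero, one_mul, Subgroup.subgroupOf_self]
  succ_le j := Subgroup.comap_mono <| congruenceSubgroup_le_of_dvd ⟨2, by ring⟩
  finiteIndex j := inferInstanceAs (((congruenceSubgroup (2 ^ j * N)).subgroupOf _).FiniteIndex)
  iInf_eq_bot := iInf_congruenceTower N
  rationalCommutator_le j := by
    let f : congruenceTower N j →* congruenceSubgroup (2 ^ j * N) :=
      (congruenceSubgroup N).subtype.subgroupComap _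
    rintro _ ⟨g, hg, rfl⟩
    have := map_rationalCommutator_le_congruenceSubgroup_two_mul (hN.mul_left (2 ^ j))
      ⟨f g, map_rationalCommutator_le f ⟨g, hg, rfl⟩, rfl⟩
    rwa [← mul_assoc, ← pow_succ'] at this

end CongruenceTower

theorem proposition3p3_general {N : ℕ} [NeZero N] (hN : 4 ∣ N) :
    ∃ T : ℕ → Subgroup (congruenceSubgroup N),
      IsRFRSTower T ∧
        ∀ j, ∃ n : ℕ,
          congruenceSubgroup (2 ^ n * N) ≤ (T j).map (congruenceSubgroup N).subtype := by
  refine ⟨congruenceTower N, isRFRSTower_congruenceTower N hN, fun j => ⟨j, ?_⟩⟩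
  rw [congruenceTower, Subgroup.subgroupOf_map_subtype]
  exact le_inf le_rfl (congruenceSubgroup_le_of_dvd (dvd_mul_left N _))

theorem proposition3p3 :
    ∃ T : ℕ → Subgroup (congruenceSubgroup 4),
      IsRFRSTower T ∧
        ∀ j, ∃ n : ℕ, congruenceSubgroup (2 ^ n) ≤ (T j).map (congruenceSubgroup 4).subtype := by
  obtain ⟨T, hT, le⟩ := proposition3p3_general (dvd_refl 4)
  exact ⟨T, hT, fun j => (le j).imp' (· + 2) fun n hn => by rwa [pow_add]⟩
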